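/- Let $q=2^h$ with $h\ge 3$, let $\alpha$ be a primitive element of $\mathbb F_q$, and let $\alpha_i=\alpha^i$ for $1\le i\le q-1$. For $3\le k\le q-4$ let $\mathcal C_k\subseteq\mathbb F_q^{\,q-1}$ be the linear code spanned by the $k$ vectors $(\alpha_1^{e},\alpha_2^{e},\dots,\alpha_{q-1}^{e})$ with $e\in\{0,1,\dots,k-2,k\}$, and let $\mathcal C_k^\perp$ be its Euclidean dual. An $[n,\kappa,d]_q$ code is a $\kappa$-dimensional subspace of $\mathbb F_q^n$ with minimum Hamming distance $d$; its Singleton defect is $n-\kappa-d+1$, and it is called $1$-MDS if both it and its dual have Singleton defect $1$. A $t$-$(n,m,\lambda)$ design on a set $P$ of $n$ points ($1\le t\le m\le n$) is a set of $m$-subsets of $P$, called blocks, such that every $t$-subset of $P$ lies in exactly $\lambda$ blocks. The minimum weight codewords of a code over $\mathbb F_q$ of length $n$ support such a design if the multiset of their supports (subsets of the set $P$ of the $n$ coordinate positions, one for each minimum weight codeword) consists of the blocks of the design, each with multiplicity exactly $q-1$. Then for each $3\le k\le q-4$ the code $\mathcal C_k$ is a $1$-MDS $[q-1,k,q-k-1]_q$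 code. Moreover, the minimum weight codewords of $\mathcal C_k^\perp$ support a $2$-$(q-1,k,\lambda_1)$ design and the minimum weight codewords of $\mathcal C_k$ support a $2$-$(q-1,q-k-1,\lambda_2)$ design, where $$\lambda_1=\sum_{i=0}^{k-2}\sum_{j=0}^{k-2-i}(-1)^{i+j}N(i,j),\qquad \lambda_2=\frac{\lambda_1\binom{q-3}{k}}{\binom{q-3}{k-2}},$$ and $$N(i,j)=\begin{cases}\dfrac1q\left[\dbinom{q-1}{k-i-j-2}+(-1)^{k-i-j+\lfloor\frac{k-i-j}{2}\rfloor-1}(q-1)\dbinom{\frac q2-1}{\lfloor\frac{k-i-j}{2}\rfloor-1}\right],& ij\text{ odd},\\[3ex]\dfrac1q\left[\dbinom{q-1}{k-i-j-2}+(-1)^{k-i-j+\lfloor\frac{k-i-j}{2}\rfloor}\dbinom{\frac q2-1}{\lfloor\frac{k-i-j}{2}\rfloor-1}\right],& ij\text{ even}.\end{cases}$$ -/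

import Mathlib

open scoped Matrix

noncomputable section

namespace LinCode

/-- The support of a vector: the set of positions of its nonzero coordinates. -/
def supp {F : Type*} [Field F] [DecidableEq F] {n : ℕ} (c : Fin n → F) : Finset (Fin n) :=
  Finset.univ.filter fun i => c i ≠ 0

/-- The minimum distance of a linear code (a subspace of `F ^ n`): the least Hamming distance
between two distinct codewords. -/
def minDist {F : Type*} [Field F] [DecidableEq F] {n : ℕ} (C : Submodule F (Fin n → F)) : ℕ :=
  sInf {d : ℕ | ∃ x ∈ C, ∃ y ∈ C, x ≠ y ∧ hammingDist x y = d}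

/-- The Euclidean dual code `{y | ⟨x, y⟩ = 0 for all x ∈ C}`. -/
def dual {F : Type*} [Field F] {n : ℕ} (C : Submodule F (Fin n → F)) :
    Submodule F (Fin n → F) where
  carrier := {y | ∀ x ∈ C, x ⬝ᵥ y = 0}
  zero_mem' := by
    intro x _
    exact dotProduct_zero x
  add_mem' := by
    intro a b ha hb x hx
    rw [dotProduct_add, ha x hx, hb x hx, add_zero]
  smul_mem' := by
    intro r a ha x hx
    rw [dotProduct_smul, ha x hx, smul_zero]

/-- `C` is an `[n, k, d]` linear code over `F` (the length `n` is part of the type of `C`). -/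
def HasParams {F : Type*} [Field F] [DecidableEq F] {n : ℕ} (C : Submodule F (Fin n → F))
    (k d : ℕ) : Prop :=
  Module.finrank F C = k ∧ minDist C = d

/-- The Singleton defect `n - k - d + 1` of an `[n, k, d]` code. -/
def singletonDefect {F : Type*} [Field F] [DecidableEq F] {n : ℕ}
    (C : Submodule F (Fin n → F)) : ℤ :=
  (n : ℤ) - (Module.finrank F C : ℤ) - (minDist C : ℤ) + 1

/-- `C` is `l`-MDS: both `C` and its dual have Singleton defect `l`. -/
def IsMDSOfDefect {F : Type*} [Field F] [DecidableEq F] {n : ℕ} (l : ℕ)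
    (C : Submodule F (Fin n → F)) : Prop :=
  singletonDefect C = l ∧ singletonDefect (dual C) = l

/-- `(P, B)` is a `t`-`(n, k, lam)` design: `|P| = n`, `B` is a set of `k`-subsets of `P` (so no
block is repeated), and each `t`-subset of `P` is contained in exactly `lam` elements of `B`. -/
structure IsDesign {P : Type*} [Fintype P] [DecidableEq P] (t n k lam : ℕ)
    (B : Finset (Finset P)) : Prop where
  one_le_t : 1 ≤ t
  t_le_k : t ≤ k
  k_le_n : k ≤ n
  card_points : Fintype.card P = n
  card_block : ∀ b ∈ B, b.card = k
  balanced : ∀ T : Finset P, T.card = t → (B.filter fun b => T ⊆ b).card = lam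

/-- The multiset of the supports of the codewords of weight `w` in `C`, one entry for each such
codeword. -/
def suppMultiset {F : Type*} [Field F] [Fintype F] [DecidableEq F] {n : ℕ}
    (C : Submodule F (Fin n → F)) (w : ℕ) : Multiset (Finset (Fin n)) :=
  (Set.toFinite {c : Fin n → F | c ∈ C ∧ hammingNorm c = w}).toFinset.val.map supp

/-- The codewords of minimum weight of `C` support a `t`-`(v, k, lam)` design: dividing all
multiplicities in the multiset of their supports by `|F| - 1` gives the blocks of such a design. -/
def MinWeightSupportsDesign {F : Type*} [Field F] [Fintype F] [DecidableEq F] {n : ℕ}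
    (C : Submodule F (Fin n → F)) (t v k lam : ℕ) : Prop :=
  ∃ B : Finset (Finset (Fin n)),
    suppMultiset C (minDist C) = (Fintype.card F - 1) • B.val ∧ IsDesign t v k lam B

/-- The `k × (q - 1)` matrix whose columns belong to `α, α ^ 2, …, α ^ (q - 1)` and whose rows are
the powers with exponents `0, 1, …, k - 2, k`. -/
def genMatrix {F : Type*} [Field F] (q k : ℕ) (α : F) : Matrix (Fin k) (Fin (q - 1)) F :=
  fun i j => (α ^ ((j : ℕ) + 1)) ^ (if (i : ℕ) + 1 = k then k else (i : ℕ))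

/-- The code generated by the rows of `genMatrix q k α`. -/
def codeC {F : Type*} [Field F] (q k : ℕ) (α : F) : Submodule F (Fin (q - 1) → F) :=
  Submodule.span F (Set.range (genMatrix q k α))

/-- The rational number `N(i, j)`; it is only used for `i + j ≤ k - 2`, where all the
natural-number subtractions are exact. -/
def subsetSumN (q k i j : ℕ) : ℚ :=
  if Odd (i * j) then
    (1 / (q : ℚ)) * (((q - 1).choose (k - i - j - 2) : ℚ)
      + (-1 : ℚ) ^ ((k - i - j) + (k - i - j) / 2 - 1) * ((q : ℚ) - 1)
        * ((q / 2 - 1).choose ((k - i - j) / 2 - 1) : ℚ))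
  else
    (1 / (q : ℚ)) * (((q - 1).choose (k - i - j - 2) : ℚ)
      + (-1 : ℚ) ^ ((k - i - j) + (k - i - j) / 2)
        * ((q / 2 - 1).choose ((k - i - j) / 2 - 1) : ℚ))

/-- `λ₁`, the sum over `0 ≤ i ≤ k - 2` and `0 ≤ j ≤ k - 2 - i` of `(-1) ^ (i + j) * N(i, j)`. -/
def lambdaOne (q k : ℕ) : ℚ :=
  ∑ i ∈ Finset.Icc 0 (k - 2), ∑ j ∈ Finset.Icc 0 (k - 2 - i),
    (-1 : ℚ) ^ (i + j) * subsetSumN q k i j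

/-- `λ₂ = λ₁ * binom (q - 3) k / binom (q - 3) (k - 2)`. -/
def lambdaTwo (q k : ℕ) : ℚ :=
  lambdaOne q k * ((q - 3).choose k : ℚ) / ((q - 3).choose (k - 2) : ℚ)

end LinCode

end

namespace LinCode

open Finset Polynomial

/-! Codewords are the values, at the nonzero elements of F, of polynomials of degree at most k
without X^(k-1) term. A nonzero one has at most k roots; if it has k, it is a multiple of ∏(X -
root), and the missing term says that the roots sum to zero. So the minimum weight supports of the
code are the complements of zero-sum k-sets. Testing a dual word against such polynomials shows that
the dual supports are the zero-sum k-sets themselves (`supp_mem_zeroSumSets`,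
`exists_mem_dual_codeC_supp`). Such sets exist for 3 ≤ k ≤ q - 4 (`zeroSumSets_nonempty`), which
fixes both minimum distances.

The zero-sum k-sets through x and y correspond to the (k-2)-subsets of F* \ {x, y} with sum x + y.
Restoring x and y to the ground set gives an alternating double sum of subset counts in F*
(`numSubsets_erase`). By scaling, these counts depend only on whether the target is zero, which in
characteristic 2 happens exactly for i and j odd. Hence λ₁ does not depend on the pair. One additive
character and the total count determine the two values, giving N(i, j). Complementation yields the
second design with equally many blocks, and double counting gives λ₂. -/

/-- The number of `m`-element subsets of `s` with sum `b`. -/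
def numSubsets {G : Type*} [AddCommGroup G] [DecidableEq G] (s : Finset G) (m : ℕ) (b : G) : ℕ :=
  #{t ∈ powersetCard m s | ∑ z ∈ t, z = b}

/-! ### Subset-sum counts in a finite abelian group. -/

section NumSubsets

variable {G : Type*} [AddCommGroup G] [DecidableEq G]

theorem numSubsets_zero (s : Finset G) (b : G) :
    numSubsets s 0 b = if b = 0 then 1 else 0 := by
  unfold numSubsets
  rw [powersetCard_zero, filter_singleton]
  split_ifs <;> simp_all [eq_comm]

theorem numSubsets_insert {s : Finset G} {x : G} (hx : x ∉ s) (m : ℕ) (b : G) :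
    numSubsets (insert x s) (m + 1) b = numSubsets s (m + 1) b + numSubsets s m (b - x) := by
  unfold numSubsets
  rw [powersetCard_succ_insert hx, filter_union, card_union_of_disjoint]
  · congr 1
    rw [filter_image, card_image_of_injOn]
    · congr 1
      refine filter_congr fun t ht => ?_
      have : x ∉ t := fun h => hx ((mem_powersetCard.1 ht).1 h)
      rw [sum_insert this, eq_sub_iff_add_eq, add_comm]
    · intro t ht u hu h
      have h1 : x ∉ t := fun h => hx ((mem_powersetCard.1 (mem_filter.1 ht).1).1 h)
      have h2 : x ∉ u := fun h => hx ((mem_powersetCard.1 (mem_filter.1 hu).1).1 h)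
      have h3 : insert x t = insert x u := h
      rw [← erase_insert h1, h3, erase_insert h2]
  · rw [Finset.disjoint_left]
    intro t ht ht'
    obtain ⟨u, -, rfl⟩ := mem_image.1 (mem_filter.1 ht').1
    exact hx ((mem_powersetCard.1 (mem_filter.1 ht).1).1 (mem_insert_self _ _))

/-- Splitting the subsets of `s` by whether they contain `x` expresses the count without `x` as the
full count minus a count without `x` for smaller `m`; iterating gives the alternating sum. -/
theorem numSubsets_erase {s : Finset G} {x : G} (hx : x ∈ s) (m : ℕ) (b : G) :
    (numSubsets (s.erase x) m b : ℚ) =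
      ∑ i ∈ Icc 0 m, (-1 : ℚ) ^ i * numSubsets s (m - i) (b - i • x) := by
  induction m generalizing b with
  | zero => simp [numSubsets_zero]
  | succ m ih =>
    have h := numSubsets_insert (notMem_erase x s) m b
    rw [insert_erase hx] at h
    have h' : (numSubsets (s.erase x) (m + 1) b : ℚ) =
        numSubsets s (m + 1) b - numSubsets (s.erase x) m (b - x) := by
      rw [h]; push_cast; ring
    rw [h', ih, ← Nat.range_succ_eq_Icc_zero, ← Nat.range_succ_eq_Icc_zero,
      sum_range_succ' _ (m + 1)]
    simp only [pow_zero, one_mul, zero_smul, sub_zero, Nat.sub_zero]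
    rw [sub_eq_add_neg, add_comm, ← sum_neg_distrib]
    congr 1
    refine sum_congr rfl fun i _ => ?_
    rw [Nat.add_sub_add_right, succ_nsmul, pow_succ, sub_sub, add_comm x]
    ring

theorem sum_numSubsets [Fintype G] (s : Finset G) (m : ℕ) :
    ∑ b, numSubsets s m b = (#s).choose m := by
  rw [← card_powersetCard]
  exact (card_eq_sum_card_fiberwise (f := fun t : Finset G => ∑ z ∈ t, z) (t := univ)
    (fun _ _ => by simp)).symm

theorem addChar_map_sum (ψ : AddChar G ℂ) (t : Finset G) : ψ (∑ z ∈ t, z) = ∏ z ∈ t, ψ z := by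
  induction t using Finset.induction_on with
  | empty => simp
  | insert a t ha ih => rw [sum_insert ha, prod_insert ha, AddChar.map_add_eq_mul, ih]

/-- Expanding the product, the coefficient of X^m collects ψ(sum of t) over the m-subsets t;
grouping these by their sum gives the left side. -/
theorem sum_addChar_mul_numSubsets [Fintype G] (ψ : AddChar G ℂ) (s : Finset G) (m : ℕ) :
    ∑ b, ψ b * numSubsets s m b = (∏ z ∈ s, (1 + C (ψ z) * X : ℂ[X])).coeff m := by
  have h1 : (∏ z ∈ s, (1 + C (ψ z) * X : ℂ[X])).coeff m =
      ∑ t ∈ powersetCard m s, ψ (∑ z ∈ t, z) := by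
    rw [prod_one_add, finsetSum_coeff, powersetCard_eq_filter, sum_filter]
    refine sum_congr rfl fun t _ => ?_
    rw [prod_mul_distrib, prod_const, ← map_prod, coeff_C_mul, coeff_X_pow,
      addChar_map_sum]
    simp [eq_comm]
  rw [h1, ← sum_fiberwise_of_maps_to (t := univ) (g := fun t : Finset G => ∑ z ∈ t, z)
    (fun _ _ => mem_univ _)]
  refine sum_congr rfl fun b _ => ?_
  rw [sum_congr rfl (g := fun _ => ψ b) (fun t ht => by rw [(mem_filter.1 ht).2]), sum_const,
    nsmul_eq_mul, mul_comm, numSubsets]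

end NumSubsets

theorem coeff_one_sub_X_sq_pow_mul (N m : ℕ) :
    ((1 - X ^ 2 : ℂ[X]) ^ N * (1 - X)).coeff m =
      (-1) ^ (m + m / 2) * (N.choose (m / 2) : ℂ) := by
  have h0 : ∀ j, ((1 - X : ℂ[X]) ^ N).coeff j = (-1) ^ j * (N.choose j : ℂ) := by
    intro j
    have : (1 - X : ℂ[X]) = (1 + X : ℂ[X]).comp (C (-1) * X) := by simp [sub_eq_add_neg]
    rw [this, ← pow_comp, comp_C_mul_X_coeff, coeff_one_add_X_pow, mul_comm]
  have h1 : (1 - X ^ 2 : ℂ[X]) ^ N = expand ℂ 2 ((1 - X) ^ N) := by simp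
  rw [h1, mul_sub, mul_one, coeff_sub]
  rcases m with _ | m
  · rw [coeff_expand two_pos]; simp [h0]
  rw [coeff_mul_X, coeff_expand two_pos, coeff_expand two_pos]
  rcases Nat.even_or_odd' m with ⟨r, rfl | rfl⟩
  · have : ¬ 2 ∣ 2 * r + 1 := by omega
    rw [if_neg this, if_pos (by omega), h0]
    rw [show (2 * r + 1) / 2 = r by omega, show 2 * r / 2 = r by omega]
    rw [pow_add (-1 : ℂ) (2 * r + 1), pow_succ, pow_mul]
    simp
  · have : ¬ 2 ∣ 2 * r + 1 := by omega
    rw [if_neg this, if_pos (by omega), h0]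
    rw [show (2 * r + 1 + 1) / 2 = r + 1 by omega]
    rw [pow_add (-1 : ℂ) (2 * r + 1 + 1), show 2 * r + 1 + 1 = 2 * (r + 1) by ring, pow_mul]
    simp

/-! ### Subset sums of nonzero elements in characteristic 2. -/

section CharTwo

variable {F : Type*} [Field F] [Fintype F] [DecidableEq F]

theorem numSubsets_smul {a : F} (ha : a ≠ 0) (m : ℕ) (b : F) :
    numSubsets (univ.erase (0 : F)) m (a * b) = numSubsets (univ.erase (0 : F)) m b := by
  unfold numSubsets
  symm
  refine card_bij' (fun t _ => t.image (a * ·)) (fun t _ => t.image (a⁻¹ * ·)) ?_ ?_ ?_ ?_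
  · intro t ht
    simp only [mem_filter, mem_powersetCard, subset_iff, mem_erase, mem_univ, and_true] at ht ⊢
    refine ⟨⟨?_, ?_⟩, ?_⟩
    · intro x hx
      obtain ⟨y, hy, rfl⟩ := mem_image.1 hx
      exact mul_ne_zero ha (ht.1.1 hy)
    · rw [card_image_of_injective _ (mul_right_injective₀ ha), ht.1.2]
    · rw [sum_image (mul_right_injective₀ ha).injOn, ← mul_sum, ht.2]
  · intro t ht
    have ha' := inv_ne_zero ha
    simp only [mem_filter, mem_powersetCard, subset_iff, mem_erase, mem_univ, and_true] at ht ⊢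
    refine ⟨⟨?_, ?_⟩, ?_⟩
    · intro x hx
      obtain ⟨y, hy, rfl⟩ := mem_image.1 hx
      exact mul_ne_zero ha' (ht.1.1 hy)
    · rw [card_image_of_injective _ (mul_right_injective₀ ha'), ht.1.2]
    · rw [sum_image (mul_right_injective₀ ha').injOn, ← mul_sum, ht.2, inv_mul_cancel_left₀ ha]
  · intro t _
    simp [image_image, Function.comp_def, ha]
  · intro t _
    simp [image_image, Function.comp_def, ha]

/-- In characteristic 2 characters take only the values ±1, and a nontrivial one takes each on q/2
elements because its values sum to zero. Omitting z = 0 removes one factor 1 + X. -/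
theorem exists_addChar_prod [CharP F 2] : ∃ ψ : AddChar F ℂ, ψ ≠ 0 ∧
    ∏ z ∈ univ.erase (0 : F), (1 + C (ψ z) * X : ℂ[X]) =
      (1 - X ^ 2) ^ (Fintype.card F / 2 - 1) * (1 - X) := by
  obtain ⟨ψ, hψ⟩ := AddChar.exists_apply_ne_zero.2 (one_ne_zero (α := F))
  have hψ0 : ψ ≠ 0 := by rintro rfl; simp at hψ
  refine ⟨ψ, hψ0, ?_⟩
  have hpm : ∀ z, ψ z = 1 ∨ ψ z = -1 := fun z => by
    have : ψ z * ψ z = 1 := by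
      rw [← AddChar.map_add_eq_mul, CharTwo.add_self_eq_zero, AddChar.map_zero_eq_one]
    exact mul_self_eq_one_iff.1 this
  set A : Finset F := {z | ψ z = 1} with hA
  set B : Finset F := {z | ¬ ψ z = 1} with hB
  have hAB : #A + #B = Fintype.card F := card_filter_add_card_filter_not _
  have hABeq : #A = #B := by
    have h := AddChar.sum_eq_zero_iff_ne_zero.2 hψ0
    rw [← sum_filter_add_sum_filter_not univ (fun z => ψ z = 1)] at h
    rw [sum_congr rfl (g := fun _ => (1 : ℂ)) (fun z hz => (mem_filter.1 hz).2),
      sum_congr rfl (s₁ := univ.filter fun z => ¬ ψ z = 1) (g := fun _ => (-1 : ℂ))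
      (fun z hz => (hpm z).resolve_left (mem_filter.1 hz).2)] at h
    simp only [sum_const, nsmul_eq_mul, mul_one, mul_neg] at h
    exact_mod_cast add_neg_eq_zero.1 h
  have h0A : (0 : F) ∈ A := by simp [hA]
  have hApos : 0 < #A := card_pos.2 ⟨0, h0A⟩
  have hsplit : ∏ z ∈ univ.erase (0 : F), (1 + C (ψ z) * X : ℂ[X]) =
      (∏ z ∈ A.erase 0, (1 + C (ψ z) * X : ℂ[X])) * ∏ z ∈ B, (1 + C (ψ z) * X : ℂ[X]) := by
    rw [← prod_union]
    · congr 1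
      ext z
      by_cases hz : ψ z = 1 <;> simp [hA, hB, hz]
      rintro rfl
      simp at hz
    · rw [Finset.disjoint_left]
      intro z hz hz'
      exact (mem_filter.1 hz').2 (mem_filter.1 (mem_of_mem_erase hz)).2
  rw [hsplit, prod_congr rfl (g := fun _ => (1 + X : ℂ[X])) (fun z hz => by
      rw [(mem_filter.1 (mem_of_mem_erase hz)).2]; simp),
    prod_congr rfl (s₁ := B) (g := fun _ => (1 - X : ℂ[X])) (fun z hz => by
      rw [(hpm z).resolve_left (mem_filter.1 hz).2]; simp [sub_eq_add_neg]),
    prod_const, prod_const, card_erase_of_mem h0A, ← hABeq]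
  obtain ⟨N, hN⟩ : ∃ N, #A = N + 1 := ⟨#A - 1, by omega⟩
  rw [hN, show Fintype.card F / 2 - 1 = N by omega, Nat.add_sub_cancel, pow_succ (1 - X : ℂ[X]),
    ← mul_assoc, ← mul_pow]
  congr 2
  ring

theorem numSubsets_eq_one {b : F} (hb : b ≠ 0) (m : ℕ) :
    numSubsets (univ.erase (0 : F)) m b = numSubsets (univ.erase (0 : F)) m 1 := by
  conv_lhs => rw [← mul_one b]
  exact numSubsets_smul hb m 1

/-- The counts agree at all nonzero targets, where ψ sums to -1, so the character sum collapses to a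
difference of two counts. -/
theorem numSubsets_zero_sub [CharP F 2] (m : ℕ) :
    (numSubsets (univ.erase (0 : F)) m 0 : ℚ) - numSubsets (univ.erase (0 : F)) m 1 =
      (-1) ^ (m + m / 2) * ((Fintype.card F / 2 - 1).choose (m / 2) : ℚ) := by
  obtain ⟨ψ, hψ, hprod⟩ := exists_addChar_prod (F := F)
  have h := sum_addChar_mul_numSubsets ψ (univ.erase (0 : F)) m
  rw [hprod, coeff_one_sub_X_sq_pow_mul] at h
  have hsum := AddChar.sum_eq_zero_iff_ne_zero.2 hψ
  rw [← add_sum_erase univ _ (mem_univ (0 : F))] at h hsum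
  rw [sum_congr rfl (g := fun b => ψ b * (numSubsets (univ.erase (0 : F)) m 1 : ℂ))
    (fun b hb => by rw [numSubsets_eq_one (ne_of_mem_erase hb)]), ← sum_mul] at h
  rw [AddChar.map_zero_eq_one] at h hsum
  rw [eq_neg_of_add_eq_zero_right hsum] at h
  have h' : (numSubsets (univ.erase (0 : F)) m 0 : ℂ) - numSubsets (univ.erase (0 : F)) m 1 =
      (-1) ^ (m + m / 2) * ((Fintype.card F / 2 - 1).choose (m / 2) : ℂ) := by
    rw [← h]; ring
  exact_mod_cast h'

theorem numSubsets_zero_add (m : ℕ) :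
    (numSubsets (univ.erase (0 : F)) m 0 : ℚ)
      + (Fintype.card F - 1) * numSubsets (univ.erase (0 : F)) m 1 =
      ((Fintype.card F - 1).choose m : ℚ) := by
  have h := sum_numSubsets (univ.erase (0 : F)) m
  rw [← add_sum_erase univ _ (mem_univ (0 : F)), sum_congr rfl
    (g := fun _ => numSubsets (univ.erase (0 : F)) m 1)
    (fun b hb => numSubsets_eq_one (ne_of_mem_erase hb) m), sum_const, smul_eq_mul,
    card_erase_of_mem (mem_univ _), card_univ] at h
  rw [← h]
  push_cast [Fintype.card_pos]
  rfl

theorem numSubsets_eq_subsetSumN [CharP F 2] {x y : F} (hx : x ≠ 0) (hy : y ≠ 0) (hxy : x ≠ y)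
    {k i j : ℕ} (hk : i + j + 2 ≤ k) :
    (numSubsets (univ.erase (0 : F)) (k - 2 - i - j) (x + y - i • x - j • y) : ℚ) =
      subsetSumN (Fintype.card F) k i j := by
  have hq : (Fintype.card F : ℚ) ≠ 0 := by exact_mod_cast Fintype.card_ne_zero
  have h1 := numSubsets_zero_sub (F := F) (k - 2 - i - j)
  have h2 := numSubsets_zero_add (F := F) (k - 2 - i - j)
  obtain ⟨m, rfl⟩ : ∃ m, k = i + j + 2 + m := ⟨k - (i + j + 2), by omega⟩
  have e1 : i + j + 2 + m - 2 - i - j = m := by omega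
  have e2 : i + j + 2 + m - i - j = m + 2 := by omega
  have e3 : (m + 2) / 2 - 1 = m / 2 := by omega
  have e4 : m + 2 + (m + 2) / 2 = m + m / 2 + 3 := by omega
  have e5 : m + m / 2 + 3 - 1 = m + m / 2 + 2 := by omega
  have e6 : m + 2 - 2 = m := by omega
  rw [e1] at h1 h2 ⊢
  have key : ∀ n : ℕ, ∀ z : F, z - n • z = if Odd n then 0 else z := by
    intro n z
    rw [nsmul_eq_mul]
    split_ifs with hn
    · rw [CharTwo.natCast_eq_ite]; simp [Nat.not_even_iff_odd.2 hn]
    · rw [CharTwo.natCast_eq_ite]; simp [Nat.not_odd_iff_even.1 hn]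
  have harg : x + y - i • x - j • y = (x - i • x) + (y - j • y) := by abel
  have hxy' : x + y ≠ 0 := fun h => hxy (CharTwo.add_eq_zero.1 h)
  unfold subsetSumN
  -- With m = k - i - j - 2 the exponents in N(i, j) are m + m/2 + 2 in the odd case and m + m/2 + 3
  -- otherwise; the shifts 2 and 3 account for the opposite signs.
  rw [e2, e3, e4, e5, e6, harg, key, key, pow_add (-1 : ℚ) _ 2, pow_add (-1 : ℚ) _ 3]
  by_cases hij : Odd (i * j)
  · obtain ⟨hi, hj⟩ := Nat.odd_mul.1 hij
    rw [if_pos hij, if_pos hi, if_pos hj, add_zero, ← h2]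
    field_simp
    linear_combination ((Fintype.card F : ℚ) - 1) * h1
  · have hne : (if Odd i then 0 else x) + (if Odd j then 0 else y) ≠ 0 := by
      rw [Nat.odd_mul, not_and_or] at hij
      split_ifs <;> simp_all
    rw [if_neg hij, numSubsets_eq_one hne, ← h2]
    field_simp
    linear_combination (-1 : ℚ) * h1

theorem numSubsets_erase_erase_eq_lambdaOne [CharP F 2] {x y : F} (hx : x ≠ 0) (hy : y ≠ 0)
    (hxy : x ≠ y) {k : ℕ} (hk : 2 ≤ k) :
    (numSubsets (((univ.erase (0 : F)).erase y).erase x) (k - 2) (x + y) : ℚ) =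
      lambdaOne (Fintype.card F) k := by
  unfold lambdaOne
  rw [numSubsets_erase (by simp [hx, hxy])]
  refine sum_congr rfl fun i hi => ?_
  rw [numSubsets_erase (by simp [hy]), mul_sum]
  refine sum_congr rfl fun j hj => ?_
  have := (mem_Icc.1 hi).2
  have := (mem_Icc.1 hj).2
  rw [numSubsets_eq_subsetSumN hx hy hxy (by omega), pow_add, mul_assoc]

/-- Start from {1, x, 1 + x} and repeatedly replace an element s by the two elements a and s + a,
which preserves the sum. -/
theorem exists_zeroSum_card [CharP F 2] {m : ℕ} (hm : 3 ≤ m)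
    (hm' : 2 * m ≤ Fintype.card F) :
    ∃ S : Finset F, 0 ∉ S ∧ #S = m ∧ ∑ z ∈ S, z = 0 := by
  induction m, hm using Nat.le_induction with
  | base =>
    obtain ⟨x, hx⟩ : ∃ x : F, x ∉ ({0, 1} : Finset F) := by
      by_contra! h
      have : #(univ : Finset F) ≤ #({0, 1} : Finset F) := card_le_card fun x _ => h x
      have := card_le_two (a := (0 : F)) (b := 1)
      rw [card_univ] at *
      omega
    simp only [mem_insert, mem_singleton, not_or] at hx
    have h1 : 1 + x ≠ 0 := fun h => hx.2 (CharTwo.add_eq_zero.1 h).symm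
    refine ⟨{1, x, 1 + x}, ?_, ?_, ?_⟩
    · simp [Ne.symm hx.1, h1.symm]
    · rw [card_eq_three]
      exact ⟨1, x, 1 + x, Ne.symm hx.2, by simp [hx.1], by simp, rfl⟩
    · rw [sum_insert (by simp [hx.1, Ne.symm hx.2]), sum_insert (by simp), sum_singleton,
        ← add_assoc, CharTwo.add_self_eq_zero]
  | succ m hm ih =>
    obtain ⟨S, h0, hS, hsum⟩ := ih (by omega)
    obtain ⟨s, hs⟩ : S.Nonempty := card_pos.1 (by omega)
    have hs0 : s ≠ 0 := fun h => h0 (h ▸ hs)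
    -- At most (m + 1) + (m - 1) = 2m values of `a` are forbidden, fewer than q.
    obtain ⟨a, ha⟩ : ∃ a, a ∉ insert 0 S ∪ (S.erase s).image (s + ·) := by
      by_contra! h
      have h1 : #(univ : Finset F) ≤ #(insert 0 S ∪ (S.erase s).image (s + ·)) :=
        card_le_card fun x _ => h x
      have h2 := card_union_le (insert 0 S) ((S.erase s).image (s + ·))
      have h3 := card_insert_le (0 : F) S
      have h4 : #((S.erase s).image (s + ·)) ≤ _ := card_image_le
      rw [card_erase_of_mem hs] at h4
      rw [card_univ] at h1
      omega
    simp only [mem_union, mem_insert, mem_image, mem_erase, not_or, not_exists, not_and] at ha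
    obtain ⟨⟨ha0, haS⟩, ha2⟩ := ha
    have hb : s + a ∉ S.erase s := fun h => by
      refine ha2 (s + a) (by simpa using h) ?_
      rw [← add_assoc, CharTwo.add_self_eq_zero, zero_add]
    have hab : a ∉ insert (s + a) (S.erase s) := by
      simp [hs0, haS]
    have hb0 : s + a ≠ 0 := fun h => haS ((CharTwo.add_eq_zero.1 h) ▸ hs)
    refine ⟨insert a (insert (s + a) (S.erase s)), ?_, ?_, ?_⟩
    · simp [Ne.symm ha0, h0, Ne.symm hb0]
    · rw [card_insert_of_notMem hab, card_insert_of_notMem hb, card_erase_of_mem hs]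
      omega
    · rw [sum_insert hab, sum_insert hb, ← hsum, ← add_sum_erase S _ hs, ← add_assoc,
        add_comm s a, ← add_assoc, CharTwo.add_self_eq_zero, zero_add]

end CharTwo

/-! ### Minimum weight words, their supports, and block counts. -/

section Code

variable {F : Type*} [Field F] [DecidableEq F] {n : ℕ}

theorem mem_supp {c : Fin n → F} {i : Fin n} : i ∈ supp c ↔ c i ≠ 0 := by
  simp [supp]

theorem card_supp (c : Fin n → F) : #(supp c) = hammingNorm c := rfl

theorem minDist_eq {C : Submodule F (Fin n → F)} {w : ℕ}
    (hmin : ∀ c ∈ C, c ≠ 0 → w ≤ hammingNorm c) {c : Fin n → F} (hc : c ∈ C) (hc0 : c ≠ 0)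
    (hcw : hammingNorm c = w) : minDist C = w := by
  have hmem : w ∈ {d : ℕ | ∃ x ∈ C, ∃ y ∈ C, x ≠ y ∧ hammingDist x y = d} :=
    ⟨c, hc, 0, C.zero_mem, hc0, by rw [hammingDist_zero_right, hcw]⟩
  refine le_antisymm (Nat.sInf_le hmem) (le_csInf ⟨w, hmem⟩ ?_)
  rintro d ⟨x, hx, y, hy, hxy, rfl⟩
  rw [hammingDist_eq_hammingNorm]
  exact hmin _ (C.add_mem (C.neg_mem hx) hy) fun h => hxy (neg_add_eq_zero.1 h)

/-- Two minimum weight words with the same support are proportional: cancelling one coordinate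
leaves a word of smaller weight, hence zero. Each support thus occurs once per nonzero scalar. -/
theorem suppMultiset_eq [Fintype F] {C : Submodule F (Fin n → F)} {w : ℕ} (hw : 0 < w)
    (hmin : ∀ c ∈ C, c ≠ 0 → w ≤ hammingNorm c) {B : Finset (Finset (Fin n))}
    (hB : ∀ c ∈ C, hammingNorm c = w → supp c ∈ B)
    (hex : ∀ S ∈ B, #S = w ∧ ∃ c ∈ C, supp c = S) :
    suppMultiset C w = (Fintype.card F - 1) • B.val := by
  classical
  ext S
  rw [suppMultiset, Multiset.count_map, Multiset.count_nsmul, ← filter_val, card_val]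
  by_cases hS : S ∈ B
  · obtain ⟨hSw, v, hv, rfl⟩ := hex S hS
    obtain ⟨i, hi⟩ : (supp v).Nonempty := card_pos.1 (by omega)
    have hi' := mem_supp.1 hi
    have key : (Set.toFinite {c : Fin n → F | c ∈ C ∧ hammingNorm c = w}).toFinset.filter
        (fun c => supp v = supp c) = (univ.erase (0 : F)).image (fun a => a • v) := by
      ext c
      simp only [mem_filter, Set.Finite.mem_toFinset, Set.mem_ofPred_eq, mem_image, mem_erase,
        mem_univ, and_true]
      constructor
      · rintro ⟨⟨hc, hcw⟩, hsupp⟩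
        have hci : c i ≠ 0 := mem_supp.1 (hsupp ▸ hi)
        refine ⟨c i / v i, div_ne_zero hci hi', ?_⟩
        by_contra hne
        have hd : c - (c i / v i) • v ∈ C := C.sub_mem hc (C.smul_mem _ hv)
        have hlt : #(supp (c - (c i / v i) • v)) < #(supp v) := by
          refine card_lt_card ⟨?_, fun h => ?_⟩
          · intro j hj
            by_contra hvj
            have hcj : j ∉ supp c := hsupp ▸ hvj
            rw [mem_supp, not_not] at hvj hcj
            rw [mem_supp] at hj
            simp [hvj, hcj] at hj
          · have := mem_supp.1 (h hi)
            simp [hi'] at this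
        have := hmin _ hd (sub_ne_zero.2 (Ne.symm hne))
        rw [← card_supp] at this
        omega
      · rintro ⟨a, ha, rfl⟩
        have hs : supp v = supp (a • v) := by
          ext j; simp [mem_supp, ha]
        exact ⟨⟨C.smul_mem _ hv, by rw [← card_supp, ← hs, hSw]⟩, hs⟩
    rw [key, card_image_of_injective, card_erase_of_mem (mem_univ _), card_univ,
      Multiset.count_eq_one_of_mem B.nodup hS, mul_one]
    intro a b hab
    have := congrFun hab i
    simpa [hi'] using this
  · rw [Multiset.count_eq_zero_of_notMem hS, mul_zero, card_eq_zero, filter_eq_empty_iff]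
    rintro c hc rfl
    rw [Set.Finite.mem_toFinset] at hc
    exact hS (hB c hc.1 hc.2)

end Code

/-- Counts incidences between blocks and ordered pairs of distinct points in two ways. -/
theorem IsDesign.card_mul_eq {P : Type*} [Fintype P] [DecidableEq P] {v k l : ℕ}
    {B : Finset (Finset P)} (h : IsDesign 2 v k l B) : #B * (k * (k - 1)) = l * (v * (v - 1)) := by
  have h1 : ∑ b ∈ B, #(b.offDiag) = #B * (k * (k - 1)) := by
    rw [sum_const_nat fun b hb => ?_]
    rw [offDiag_card, h.card_block b hb, Nat.mul_sub_one]
  have h2 : ∑ p ∈ (univ : Finset P).offDiag, #{b ∈ B | p ∈ b.offDiag} = l * (v * (v - 1)) := by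
    rw [sum_const_nat (m := l) fun p hp => ?_]
    · rw [offDiag_card, card_univ, h.card_points, Nat.mul_sub_one, mul_comm]
    · have hne := (mem_offDiag.1 hp).2.2
      rw [← h.balanced {p.1, p.2} (card_pair hne)]
      congr 1
      refine filter_congr fun b _ => ?_
      simp [mem_offDiag, insert_subset_iff, hne]
  rw [← h1, ← h2]
  have h3 := sum_card_bipartiteAbove_eq_sum_card_bipartiteBelow (s := B)
    (t := (univ : Finset P).offDiag) (fun b p => p ∈ b.offDiag)
  rw [← show ∑ p ∈ (univ : Finset P).offDiag, #(bipartiteBelow (fun b p => p ∈ b.offDiag) B p) =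
    ∑ p ∈ (univ : Finset P).offDiag, #{b ∈ B | p ∈ b.offDiag} from rfl, ← h3]
  refine sum_congr rfl fun b _ => congrArg card ?_
  ext p
  simp only [mem_bipartiteAbove, mem_offDiag, mem_univ, true_and]
  tauto

/-! ### Zero-sum sets of positions and their design property. -/

/-- The sets of `m` positions at which the entries of `P` sum to zero. -/
def zeroSumSets {G : Type*} [AddCommGroup G] [DecidableEq G] {n : ℕ} (P : Fin n → G) (m : ℕ) :
    Finset (Finset (Fin n)) :=
  {S ∈ powersetCard m univ | ∑ i ∈ S, P i = 0}

theorem mem_zeroSumSets {G : Type*} [AddCommGroup G] [DecidableEq G] {n : ℕ} {P : Fin n → G}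
    {m : ℕ} {S : Finset (Fin n)} : S ∈ zeroSumSets P m ↔ #S = m ∧ ∑ i ∈ S, P i = 0 := by
  simp [zeroSumSets]

theorem compl_mem_zeroSumSets {G : Type*} [AddCommGroup G] [DecidableEq G] {n : ℕ} {P : Fin n → G}
    (hP : ∑ i, P i = 0) {m : ℕ} {S : Finset (Fin n)} (hS : S ∈ zeroSumSets P m) :
    Sᶜ ∈ zeroSumSets P (n - m) := by
  rw [mem_zeroSumSets] at hS ⊢
  rw [card_compl, Fintype.card_fin, hS.1]
  refine ⟨rfl, ?_⟩
  rw [← sum_add_sum_compl S, hS.2, zero_add] at hP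
  exact hP

theorem card_zeroSumSets_sub {G : Type*} [AddCommGroup G] [DecidableEq G] {n : ℕ} {P : Fin n → G}
    (hP : ∑ i, P i = 0) {m : ℕ} (hm : m ≤ n) :
    #(zeroSumSets P (n - m)) = #(zeroSumSets P m) := by
  refine card_bij' (fun S _ => Sᶜ) (fun S _ => Sᶜ) ?_ ?_ ?_ ?_
  · intro S hS
    have := compl_mem_zeroSumSets hP hS
    rwa [Nat.sub_sub_self hm] at this
  · intro S hS
    exact compl_mem_zeroSumSets hP hS
  · intro S _; exact compl_compl S
  · intro S _; exact compl_compl S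

section Design

variable {F : Type*} [Field F] [Fintype F] [DecidableEq F] {n : ℕ} {P : Fin n → F}

/-- Deleting i and j leaves values summing to -(P i + P j), which is P i + P j in characteristic 2.
-/
theorem card_zeroSumSets_pair [CharP F 2] (hP : Function.Injective P)
    (himg : univ.image P = univ.erase 0) {i j : Fin n} (hij : i ≠ j) {m : ℕ} (hm : 2 ≤ m) :
    #{S ∈ zeroSumSets P m | {i, j} ⊆ S} =
      numSubsets (((univ.erase (0 : F)).erase (P j)).erase (P i)) (m - 2) (P i + P j) := by
  have hrange : ∀ z : F, z ≠ 0 → ∃ l, P l = z := fun z hz => by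
    have : z ∈ univ.image P := by rw [himg]; simp [hz]
    simpa using this
  have hne0 : ∀ l, P l ≠ 0 := fun l h => by
    have : P l ∈ univ.image P := mem_image_of_mem _ (mem_univ _)
    rw [himg, h] at this
    simp at this
  have hPij : P i ≠ P j := hP.ne hij
  unfold numSubsets
  refine card_bij (fun S _ => (S \ {i, j}).image P) ?_ ?_ ?_
  · intro S hS
    obtain ⟨hS, hT⟩ := mem_filter.1 hS
    obtain ⟨hc, hsum⟩ := mem_zeroSumSets.1 hS
    rw [mem_filter, mem_powersetCard, card_image_of_injective _ hP, card_sdiff_of_subset hT,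
      card_pair hij, hc, sum_image hP.injOn]
    refine ⟨⟨?_, rfl⟩, ?_⟩
    · intro z hz
      obtain ⟨l, hl, rfl⟩ := mem_image.1 hz
      simp only [mem_sdiff, mem_insert, mem_singleton, not_or] at hl
      simp [hne0, hP.eq_iff, hl.2.1, hl.2.2]
    · rw [← sum_sdiff hT, sum_pair hij] at hsum
      exact CharTwo.add_eq_zero.1 hsum
  · intro S hS S' hS' h
    have h1 := image_injective hP h
    rw [← sdiff_union_of_subset (mem_filter.1 hS).2, ← sdiff_union_of_subset (mem_filter.1 hS').2,
      h1]
  · intro t ht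
    obtain ⟨ht, hsum⟩ := mem_filter.1 ht
    obtain ⟨hsub, hc⟩ := mem_powersetCard.1 ht
    have hU : (univ.filter fun l => P l ∈ t).image P = t := by
      ext z
      simp only [mem_image, mem_filter, mem_univ, true_and]
      constructor
      · rintro ⟨l, hl, rfl⟩; exact hl
      · intro hz
        have := hsub hz
        simp only [mem_erase, mem_univ, and_true] at this
        obtain ⟨l, rfl⟩ := hrange z this.2.2
        exact ⟨l, hz, rfl⟩
    have hdisj : Disjoint (univ.filter fun l => P l ∈ t) {i, j} := by
      rw [Finset.disjoint_left]
      intro l hl hl'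
      have h1 := hsub (mem_filter.1 hl).2
      simp only [mem_erase, mem_univ, and_true] at h1
      rw [mem_insert, mem_singleton] at hl'
      rcases hl' with rfl | rfl
      · exact h1.1 rfl
      · exact h1.2.1 rfl
    refine ⟨(univ.filter fun l => P l ∈ t) ∪ {i, j}, ?_, ?_⟩
    · rw [mem_filter, mem_zeroSumSets, card_union_of_disjoint hdisj, sum_union hdisj,
        card_pair hij, sum_pair hij, ← sum_image (f := fun z => z) hP.injOn,
        ← card_image_of_injective _ hP, hU, hc, hsum, CharTwo.add_self_eq_zero]
      exact ⟨⟨by omega, rfl⟩, subset_union_right⟩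
    · rw [union_sdiff_right, hdisj.sdiff_eq_left, hU]

theorem exists_isDesign_zeroSumSets [CharP F 2] (hP : Function.Injective P)
    (himg : univ.image P = univ.erase 0) (hn : 2 ≤ n) {m : ℕ} (hm : 2 ≤ m) (hmn : m ≤ n) :
    ∃ l : ℕ, (l : ℚ) = lambdaOne (Fintype.card F) m ∧ IsDesign 2 n m l (zeroSumSets P m) := by
  have hne0 : ∀ l, P l ≠ 0 := fun l h => by
    have : P l ∈ univ.image P := mem_image_of_mem _ (mem_univ _)
    rw [himg, h] at this
    simp at this
  have key : ∀ i j : Fin n, i ≠ j →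
      (#{S ∈ zeroSumSets P m | {i, j} ⊆ S} : ℚ) = lambdaOne (Fintype.card F) m := by
    intro i j hij
    rw [card_zeroSumSets_pair hP himg hij hm]
    exact numSubsets_erase_erase_eq_lambdaOne (hne0 i) (hne0 j) (hP.ne hij) hm
  -- `lambdaOne` is rational by definition; the count for one fixed pair shows it to be a natural
  -- number.
  have h01 : (⟨0, by omega⟩ : Fin n) ≠ ⟨1, by omega⟩ := by simp
  refine ⟨_, key _ _ h01, one_le_two, hm, hmn, Fintype.card_fin n,
    fun b hb => (mem_zeroSumSets.1 hb).1, fun T hT => ?_⟩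
  obtain ⟨i, j, hij, rfl⟩ := card_eq_two.1 hT
  exact_mod_cast (key i j hij).trans (key _ _ h01).symm

theorem sum_eq_zero_of_image [CharP F 2] (hP : Function.Injective P)
    (himg : univ.image P = univ.erase 0) (hF : 2 < Fintype.card F) : ∑ i, P i = 0 := by
  rw [← sum_image (f := fun z => z) hP.injOn, himg, ← add_zero (∑ x ∈ univ.erase (0 : F), x),
    sum_erase_add _ _ (mem_univ _)]
  have := FiniteField.sum_pow_lt_card_sub_one F 1 (by omega)
  simpa using this

theorem zeroSumSets_nonempty [CharP F 2] (hP : Function.Injective P)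
    (himg : univ.image P = univ.erase 0) {m : ℕ} (hm : 3 ≤ m) (hmn : m + 4 ≤ Fintype.card F) :
    (zeroSumSets P m).Nonempty := by
  have hn : n + 1 = Fintype.card F := by
    have := congrArg card himg
    rw [card_image_of_injective _ hP, card_univ, Fintype.card_fin, card_erase_of_mem (mem_univ _),
      card_univ] at this
    omega
  have small : ∀ r, 3 ≤ r → 2 * r ≤ Fintype.card F → (zeroSumSets P r).Nonempty := by
    intro r hr hr'
    obtain ⟨S, h0, hS, hsum⟩ := exists_zeroSum_card (F := F) hr hr'
    have hU : (univ.filter fun l => P l ∈ S).image P = S := by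
      ext z
      simp only [mem_image, mem_filter, mem_univ, true_and]
      constructor
      · rintro ⟨l, hl, rfl⟩; exact hl
      · intro hz
        have : z ∈ univ.image P := by
          rw [himg, mem_erase]
          exact ⟨fun h => h0 (h ▸ hz), mem_univ _⟩
        obtain ⟨l, -, rfl⟩ := mem_image.1 this
        exact ⟨l, hz, rfl⟩
    refine ⟨univ.filter fun l => P l ∈ S, mem_zeroSumSets.2 ⟨?_, ?_⟩⟩
    · rw [← card_image_of_injective _ hP, hU, hS]
    · rw [← sum_image (f := fun z => z) hP.injOn, hU, hsum]
  -- Sizes above q/2 come from complements, of size q - 1 - m ≥ 3.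
  rcases le_or_gt (2 * m) (Fintype.card F) with h | h
  · exact small m hm h
  · obtain ⟨S, hS⟩ := small (n - m) (by omega) (by omega)
    have := compl_mem_zeroSumSets (sum_eq_zero_of_image hP himg (by omega)) hS
    rw [Nat.sub_sub_self (by omega)] at this
    exact ⟨_, this⟩

end Design

/-! ### The code as an evaluation code; dimensions. -/

section Points

variable {F : Type*} [Field F]

/-- The evaluation points `α, α ^ 2, …, α ^ (q - 1)`. -/
def point (q : ℕ) (α : F) (j : Fin (q - 1)) : F := α ^ ((j : ℕ) + 1)

theorem point_injective {q : ℕ} {α : F} (hα : IsPrimitiveRoot α (q - 1)) (hq : 1 < q) :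
    Function.Injective (point q α) := by
  intro i j hij
  have h0 : α ≠ 0 := hα.ne_zero (by omega)
  unfold point at hij
  rw [pow_succ, pow_succ] at hij
  exact Fin.ext (hα.pow_inj i.2 j.2 (mul_right_cancel₀ h0 hij))

theorem image_point [Fintype F] [DecidableEq F] {q : ℕ} {α : F} (hα : IsPrimitiveRoot α (q - 1))
    (hq : 1 < q) (hF : Fintype.card F = q) : univ.image (point q α) = univ.erase 0 := by
  refine eq_of_subset_of_card_le ?_ ?_
  · intro z hz
    obtain ⟨j, -, rfl⟩ := mem_image.1 hz
    exact mem_erase.2 ⟨pow_ne_zero _ (hα.ne_zero (by omega)), mem_univ _⟩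
  · rw [card_image_of_injective _ (point_injective hα hq), card_erase_of_mem (mem_univ _),
      card_univ, card_univ, Fintype.card_fin, hF]

/-- The exponent of the `i`-th row of the generator matrix. -/
def rowExp (k i : ℕ) : ℕ := if i + 1 = k then k else i

theorem genMatrix_apply (q k : ℕ) (α : F) (i : Fin k) (j : Fin (q - 1)) :
    genMatrix q k α i j = point q α j ^ rowExp k i := rfl

theorem rowExp_injective (k : ℕ) : Function.Injective fun i : Fin k => rowExp k i := by
  intro i j h
  have hi := i.2
  have hj := j.2
  simp only [rowExp] at h
  ext
  split_ifs at h <;> omega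

theorem rowExp_le (k : ℕ) (i : Fin k) : rowExp k i ≤ k := by
  unfold rowExp
  split_ifs <;> omega

theorem rowExp_ne (k : ℕ) (i : Fin k) : rowExp k i ≠ k - 1 := by
  have := i.2
  unfold rowExp
  split_ifs <;> omega

theorem mem_codeC {q k : ℕ} {α : F} (hk : 0 < k) {c : Fin (q - 1) → F} :
    c ∈ codeC q k α ↔ ∃ f : F[X], f.natDegree ≤ k ∧ f.coeff (k - 1) = 0 ∧
      ∀ j, c j = f.eval (point q α j) := by
  constructor
  · intro hc
    induction hc using Submodule.span_induction with
    | mem x hx =>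
      obtain ⟨i, rfl⟩ := hx
      refine ⟨X ^ rowExp k i, ?_, ?_, fun j => ?_⟩
      · rw [natDegree_X_pow]; exact rowExp_le k i
      · rw [coeff_X_pow, if_neg (rowExp_ne k i).symm]
      · rw [genMatrix_apply, eval_pow, eval_X]
    | zero => exact ⟨0, by simp, by simp, by simp⟩
    | add x y _ _ hx hy =>
      obtain ⟨f, hf, hf', hfx⟩ := hx
      obtain ⟨g, hg, hg', hgy⟩ := hy
      exact ⟨f + g, natDegree_add_le_of_degree_le hf hg, by rw [coeff_add, hf', hg', add_zero],
        fun j => by rw [Pi.add_apply, hfx, hgy, eval_add]⟩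
    | smul a x _ hx =>
      obtain ⟨f, hf, hf', hfx⟩ := hx
      exact ⟨C a * f, (natDegree_C_mul_le _ _).trans hf, by rw [coeff_C_mul, hf', mul_zero],
        fun j => by rw [Pi.smul_apply, hfx, eval_mul, eval_C, smul_eq_mul]⟩
  · rintro ⟨f, hf, hf', hc⟩
    have : c = ∑ e ∈ range (k + 1), f.coeff e • fun j => point q α j ^ e := by
      ext j
      rw [hc, eval_eq_sum_range' (Nat.lt_succ_of_le hf)]
      simp
    rw [this]
    refine Submodule.sum_mem _ fun e he => ?_
    by_cases h : e = k - 1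
    · rw [h, hf', zero_smul]; exact Submodule.zero_mem _
    · refine Submodule.smul_mem _ _ (Submodule.subset_span ?_)
      have he' := mem_range.1 he
      by_cases hek : e = k
      · refine ⟨⟨k - 1, by omega⟩, ?_⟩
        ext j
        rw [genMatrix_apply, rowExp, if_pos (by simp; omega), hek]
      · refine ⟨⟨e, by omega⟩, ?_⟩
        ext j
        rw [genMatrix_apply, rowExp, if_neg (by simp; omega)]

theorem linearIndependent_genMatrix {q k : ℕ} {α : F} (hα : IsPrimitiveRoot α (q - 1))
    (hkq : k + 1 < q) : LinearIndependent F (genMatrix q k α).row := by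
  refine Fintype.linearIndependent_iff.2 ?_
  intro g hg i
  set f : F[X] := ∑ i : Fin k, C (g i) * X ^ rowExp k i with hf
  have hdeg : f.natDegree ≤ k := natDegree_sum_le_of_forall_le _ _ fun i _ =>
    (natDegree_C_mul_X_pow_le _ _).trans (rowExp_le k i)
  have hf0 : f = 0 := by
    refine eq_zero_of_natDegree_lt_card_of_eval_eq_zero f (point_injective hα (by omega))
      (fun j => ?_) (by rw [Fintype.card_fin]; omega)
    have := congrFun hg j
    simpa [hf, eval_finsetSum, genMatrix_apply] using this
  have := congrArg (fun p => p.coeff (rowExp k i)) hf0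
  simpa [hf, finsetSum_coeff, coeff_X_pow, (rowExp_injective k).eq_iff] using this

theorem finrank_codeC {q k : ℕ} {α : F} (hα : IsPrimitiveRoot α (q - 1)) (hkq : k + 1 < q) :
    Module.finrank F (codeC q k α) = k := by
  exact (finrank_span_eq_card (linearIndependent_genMatrix hα hkq)).trans (Fintype.card_fin k)

theorem finrank_dual_codeC {q k : ℕ} {α : F} (hα : IsPrimitiveRoot α (q - 1)) (hkq : k + 1 < q) :
    Module.finrank F (dual (codeC q k α)) = q - 1 - k := by
  have h : dual (codeC q k α) = LinearMap.ker (genMatrix q k α).mulVecLin := by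
    ext y
    rw [LinearMap.mem_ker, Matrix.mulVecLin_apply]
    constructor
    · intro hy
      ext i
      exact hy _ (Submodule.subset_span ⟨i, rfl⟩)
    · intro hy x hx
      induction hx using Submodule.span_induction with
      | mem x hx => obtain ⟨i, rfl⟩ := hx; exact congrFun hy i
      | zero => exact zero_dotProduct y
      | add a b _ _ ha hb => rw [add_dotProduct, ha, hb, add_zero]
      | smul a x _ hx => rw [smul_dotProduct, hx, smul_zero]
  have h1 := (genMatrix q k α).mulVecLin.finrank_range_add_finrank_ker
  have h2 : (genMatrix q k α).rank = _ := (linearIndependent_genMatrix hα hkq).rank_matrix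
  rw [Matrix.rank, Fintype.card_fin] at h2
  rw [h2, ← h, Module.finrank_fin_fun] at h1
  omega

/-- The nodal polynomial is monic of degree `#S`, so the top coefficients cancel. Positivity of `#S`
covers a zero difference, whose `natDegree` is 0. -/
theorem natDegree_sub_C_mul_nodal_lt {ι : Type*} {S : Finset ι} (P : ι → F) {f : F[X]}
    (hS : 0 < #S) (hf : f.natDegree ≤ #S) :
    (f - C (f.coeff #S) * Lagrange.nodal S P).natDegree < #S := by
  have hle : (f - C (f.coeff #S) * Lagrange.nodal S P).natDegree ≤ #S :=
    (natDegree_sub_le_of_le hf ((natDegree_C_mul_le _ _).trans Lagrange.natDegree_nodal.le)).trans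
      (max_self _).le
  refine lt_of_le_of_ne hle fun h => ?_
  have h1 : (f - C (f.coeff #S) * Lagrange.nodal S P).coeff #S = 0 := by
    have := (Lagrange.nodal_monic (s := S) (v := P)).coeff_natDegree
    rw [Lagrange.natDegree_nodal] at this
    rw [coeff_sub, coeff_C_mul, this, mul_one, sub_self]
  have h2 := leadingCoeff_eq_zero.1 ((congrArg _ h).trans h1)
  rw [h2, natDegree_zero] at h
  omega

end Points

/-! ### Minimum weight words of the code and of its dual. -/

section Weights

variable {F : Type*} [Field F] [DecidableEq F]

theorem le_hammingNorm_of_mem_codeC {q k : ℕ} {α : F} (hα : IsPrimitiveRoot α (q - 1))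
    (hk : 0 < k) (hq : 1 < q) {c : Fin (q - 1) → F} (hc : c ∈ codeC q k α) (hc0 : c ≠ 0) :
    q - 1 - k ≤ hammingNorm c := by
  obtain ⟨f, hf, -, hcf⟩ := (mem_codeC hk).1 hc
  have hsum : #(supp c)ᶜ + hammingNorm c = q - 1 := by
    rw [← card_supp, card_compl_add_card, Fintype.card_fin]
  by_contra! hlt
  apply hc0
  have hf0 : f = 0 := by
    refine eq_zero_of_natDegree_lt_card_of_eval_eq_zero' f ((supp c)ᶜ.image (point q α)) ?_ ?_
    · intro z hz
      obtain ⟨j, hj, rfl⟩ := mem_image.1 hz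
      rw [mem_compl, mem_supp, not_not] at hj
      rw [← hcf, hj]
    · rw [card_image_of_injective _ (point_injective hα hq)]
      omega
  ext j
  rw [hcf, hf0, eval_zero, Pi.zero_apply]

/-- With k zeros, the polynomial is a scalar multiple of their nodal polynomial, whose X^(k-1)
coefficient is minus the sum of the zeros. -/
theorem compl_supp_mem_zeroSumSets {q k : ℕ} {α : F} (hα : IsPrimitiveRoot α (q - 1))
    (hk : 0 < k) (hkq : k + 1 < q) {c : Fin (q - 1) → F} (hc : c ∈ codeC q k α)
    (hcw : hammingNorm c = q - 1 - k) : (supp c)ᶜ ∈ zeroSumSets (point q α) k := by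
  obtain ⟨f, hf, hf1, hcf⟩ := (mem_codeC hk).1 hc
  have hsum : #(supp c)ᶜ + hammingNorm c = q - 1 := by
    rw [← card_supp, card_compl_add_card, Fintype.card_fin]
  have hcard : #(supp c)ᶜ = k := by omega
  refine mem_zeroSumSets.2 ⟨hcard, ?_⟩
  set Z := (supp c)ᶜ with hZ
  have hfN : f - C (f.coeff k) * Lagrange.nodal Z (point q α) = 0 := by
    have hlt := natDegree_sub_C_mul_nodal_lt (point q α) (S := Z) (f := f) (by omega)
      (by rw [hcard]; exact hf)
    rw [hcard] at hlt
    refine eq_zero_of_natDegree_lt_card_of_eval_eq_zero' _ (Z.image (point q α)) ?_ ?_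
    · intro z hz
      obtain ⟨j, hj, rfl⟩ := mem_image.1 hz
      rw [eval_sub, eval_mul, Lagrange.eval_nodal_at_node hj, mul_zero, sub_zero, ← hcf]
      rwa [hZ, mem_compl, mem_supp, not_not] at hj
    · rw [card_image_of_injective _ (point_injective hα (by omega)), hcard]
      exact hlt
  have hfk : f.coeff k ≠ 0 := by
    intro h
    rw [h, C_0, zero_mul, sub_zero] at hfN
    have : c = 0 := by ext j; rw [hcf, hfN, eval_zero, Pi.zero_apply]
    rw [this, hammingNorm_zero] at hcw
    omega
  have h1 := congrArg (fun p => p.coeff (k - 1)) hfN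
  have h2 := prod_X_sub_C_coeff_card_pred Z (point q α) (by omega)
  rw [hcard, ← Lagrange.nodal_eq] at h2
  simp only [coeff_sub, coeff_C_mul, hf1, h2, coeff_zero] at h1
  simpa [hfk] using h1

theorem exists_mem_codeC_supp {q k : ℕ} {α : F} (hα : IsPrimitiveRoot α (q - 1))
    (hk : 0 < k) (hq : 1 < q) {Z : Finset (Fin (q - 1))} (hZ : Z ∈ zeroSumSets (point q α) k) :
    ∃ c ∈ codeC q k α, supp c = Zᶜ := by
  obtain ⟨hcard, hsum⟩ := mem_zeroSumSets.1 hZ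
  refine ⟨fun j => (Lagrange.nodal Z (point q α)).eval (point q α j), ?_, ?_⟩
  · refine (mem_codeC hk).2 ⟨_, by rw [Lagrange.natDegree_nodal, hcard], ?_, fun j => rfl⟩
    have h2 := prod_X_sub_C_coeff_card_pred Z (point q α) (by omega)
    rw [hcard, ← Lagrange.nodal_eq, hsum, neg_zero] at h2
    exact h2
  · ext j
    rw [mem_supp, mem_compl, Lagrange.eval_nodal, Ne, prod_eq_zero_iff]
    simp only [sub_eq_zero, (point_injective hα hq).eq_iff]
    simp

theorem sum_eval_mul_eq_zero {q k : ℕ} {α : F} (hk : 0 < k) {y : Fin (q - 1) → F}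
    (hy : y ∈ dual (codeC q k α)) {f : F[X]} (hf : f.natDegree ≤ k) (hf1 : f.coeff (k - 1) = 0) :
    ∑ j ∈ supp y, f.eval (point q α j) * y j = 0 := by
  have h := hy _ ((mem_codeC hk).2 ⟨f, hf, hf1, fun j => rfl⟩)
  rw [← h]
  refine sum_subset (subset_univ _) fun j _ hj => ?_
  rw [mem_supp, not_not] at hj
  rw [hj, mul_zero]

/-- If the weight were below k, the nodal polynomial of the support minus i would have degree at
most k - 2, hence give a codeword; pairing with it isolates the coordinate `y i`. -/
theorem le_hammingNorm_of_mem_dual_codeC {q k : ℕ} {α : F} (hα : IsPrimitiveRoot α (q - 1))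
    (hk : 0 < k) (hq : 1 < q) {y : Fin (q - 1) → F} (hy : y ∈ dual (codeC q k α)) (hy0 : y ≠ 0) :
    k ≤ hammingNorm y := by
  by_contra! hlt
  rw [← card_supp] at hlt
  obtain ⟨i, hi⟩ := Function.ne_iff.1 hy0
  have hi' : i ∈ supp y := mem_supp.2 hi
  have hpos := card_pos.2 ⟨i, hi'⟩
  have hdeg : (Lagrange.nodal ((supp y).erase i) (point q α)).natDegree = #(supp y) - 1 := by
    rw [Lagrange.natDegree_nodal, card_erase_of_mem hi']
  have h := sum_eval_mul_eq_zero hk hy (f := Lagrange.nodal ((supp y).erase i) (point q α))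
    (by omega) (coeff_eq_zero_of_natDegree_lt (by omega))
  rw [← add_sum_erase _ _ hi', sum_eq_zero (s := (supp y).erase i) (fun j hj => by
    rw [Lagrange.eval_nodal_at_node hj, zero_mul]), add_zero] at h
  rcases mul_eq_zero.1 h with h | h
  · rw [Lagrange.eval_nodal, prod_eq_zero_iff] at h
    obtain ⟨j, hj, hj'⟩ := h
    exact ne_of_mem_erase hj (point_injective hα hq (sub_eq_zero.1 hj')).symm
  · exact hi h

/-- Now the nodal polynomial g of the support minus i has degree k - 1. Multiplying by X + s, with s
the sum of its roots, removes the X^(k-1) term; pairing with y then forces P i + s = 0. -/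
theorem supp_mem_zeroSumSets {q k : ℕ} {α : F} (hα : IsPrimitiveRoot α (q - 1))
    (hk : 2 ≤ k) (hq : 1 < q) {y : Fin (q - 1) → F} (hy : y ∈ dual (codeC q k α))
    (hyw : hammingNorm y = k) : supp y ∈ zeroSumSets (point q α) k := by
  refine mem_zeroSumSets.2 ⟨hyw, ?_⟩
  rw [← card_supp] at hyw
  obtain ⟨i, hi⟩ : (supp y).Nonempty := card_pos.1 (by omega)
  set g := Lagrange.nodal ((supp y).erase i) (point q α) with hg
  have hcard : #((supp y).erase i) = k - 1 := by rw [card_erase_of_mem hi, hyw]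
  have hdeg : g.natDegree = k - 1 := by rw [Lagrange.natDegree_nodal, hcard]
  have hgk : g.coeff (k - 1) = 1 := by
    rw [← hdeg]; exact Lagrange.nodal_monic.coeff_natDegree
  have hgk' : g.coeff (k - 2) = - ∑ j ∈ (supp y).erase i, point q α j := by
    have := prod_X_sub_C_coeff_card_pred ((supp y).erase i) (point q α) (by omega)
    rwa [hcard, ← Lagrange.nodal_eq] at this
  set s := ∑ j ∈ (supp y).erase i, point q α j with hs
  have hfdeg : ((X + C s) * g).natDegree ≤ k := by
    refine natDegree_mul_le.trans ?_
    rw [natDegree_X_add_C, hdeg]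
    omega
  have hf1 : ((X + C s) * g).coeff (k - 1) = 0 := by
    rw [add_mul, coeff_add, coeff_C_mul, hgk, show k - 1 = k - 2 + 1 by omega, coeff_X_mul, hgk']
    ring
  have h := sum_eval_mul_eq_zero (by omega) hy hfdeg hf1
  rw [← add_sum_erase _ _ hi, sum_eq_zero (s := (supp y).erase i) (fun j hj => by
    rw [eval_mul, Lagrange.eval_nodal_at_node hj, mul_zero, zero_mul]), add_zero] at h
  rw [← add_sum_erase _ _ hi]
  have hgi : g.eval (point q α i) ≠ 0 := by
    rw [hg, Lagrange.eval_nodal, Ne, prod_eq_zero_iff]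
    rintro ⟨j, hj, hj'⟩
    exact ne_of_mem_erase hj (point_injective hα hq (sub_eq_zero.1 hj')).symm
  simpa [hgi, mem_supp.1 hi] using h

theorem exists_mem_dual_codeC_supp {q k : ℕ} {α : F} (hα : IsPrimitiveRoot α (q - 1))
    (hk : 0 < k) (hq : 1 < q) {S : Finset (Fin (q - 1))} (hS : S ∈ zeroSumSets (point q α) k) :
    ∃ y ∈ dual (codeC q k α), supp y = S := by
  obtain ⟨hcard, hsum⟩ := mem_zeroSumSets.1 hS
  have hinj := point_injective hα hq
  -- With these Lagrange weights, pairing with f gives the X^(k-1) coefficient of its interpolant on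
  -- S, which is f minus a multiple of the nodal polynomial; that coefficient vanishes as S has zero
  -- sum.
  refine ⟨fun j => if j ∈ S then (∏ l ∈ S.erase j, (point q α j - point q α l))⁻¹ else 0, ?_, ?_⟩
  · intro x hx
    obtain ⟨f, hf, hf1, hxf⟩ := (mem_codeC hk).1 hx
    set g := f - C (f.coeff k) * Lagrange.nodal S (point q α) with hg
    have hlt : g.natDegree < k := by
      have := natDegree_sub_C_mul_nodal_lt (point q α) (S := S) (f := f) (by omega)
        (by rw [hcard]; exact hf)
      rwa [hcard] at this
    have hg1 : g.coeff (k - 1) = 0 := by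
      have h2 := prod_X_sub_C_coeff_card_pred S (point q α) (by omega)
      rw [hcard, ← Lagrange.nodal_eq, hsum, neg_zero] at h2
      rw [hg, coeff_sub, coeff_C_mul, h2, hf1, mul_zero, sub_zero]
    have h := Lagrange.coeff_eq_sum (s := S) (v := point q α) hinj.injOn (P := g)
      (by rw [hcard]; exact (degree_le_natDegree).trans_lt (by exact_mod_cast hlt))
    rw [hcard, hg1] at h
    refine Eq.trans ?_ h.symm
    rw [dotProduct]
    simp only [mul_ite, mul_zero]
    rw [sum_ite_mem, univ_inter]
    refine sum_congr rfl fun j hj => ?_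
    rw [hxf, div_eq_mul_inv, hg, eval_sub, eval_mul, Lagrange.eval_nodal_at_node hj, mul_zero,
      sub_zero]
  · ext j
    rw [mem_supp]
    by_cases hj : j ∈ S
    · simp only [hj, if_true, iff_true]
      refine inv_ne_zero (prod_ne_zero_iff.2 fun l hl h => ?_)
      exact ne_of_mem_erase hl (hinj (sub_eq_zero.1 h)).symm
    · simp [hj]

end Weights

theorem choose_mul_eq_choose_mul (N r : ℕ) :
    N.choose (r + 2) * ((r + 2) * (r + 1)) = N.choose r * ((N - r) * (N - r - 1)) := by
  have h1 := Nat.choose_succ_right_eq N r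
  have h2 := Nat.choose_succ_right_eq N (r + 1)
  rw [← mul_assoc, h2, mul_right_comm, h1, mul_assoc, Nat.sub_sub]

end LinCode

/-! ### The theorem: parameters, both designs, and the relation between λ₁ and λ₂. -/

theorem mainTheorem1 {F : Type*} [Field F] [Fintype F] [DecidableEq F]
    (q h : ℕ) (hh : 3 ≤ h) (hq : q = 2 ^ h) (hF : Fintype.card F = q)
    (α : F) (hα : IsPrimitiveRoot α (q - 1))
    (k : ℕ) (hk3 : 3 ≤ k) (hkq : k ≤ q - 4) :
    LinCode.IsMDSOfDefect 1 (LinCode.codeC q k α) ∧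
    LinCode.HasParams (LinCode.codeC q k α) k (q - k - 1) ∧
    ∃ l₁ l₂ : ℕ,
      (l₁ : ℚ) = LinCode.lambdaOne q k ∧
      (l₂ : ℚ) = LinCode.lambdaTwo q k ∧
      LinCode.MinWeightSupportsDesign (LinCode.dual (LinCode.codeC q k α)) 2 (q - 1) k l₁ ∧
      LinCode.MinWeightSupportsDesign (LinCode.codeC q k α) 2 (q - 1) (q - k - 1) l₂ := by
  open LinCode in
  have hchar : CharP F 2 := charP_of_card_eq_prime_pow (hF.trans hq)
  have hP := point_injective hα (by omega)
  have himg := image_point hα (by omega) hF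
  have hsum := sum_eq_zero_of_image hP himg (by omega)
  have hmin := fun c hc hc0 => le_hammingNorm_of_mem_codeC (k := k) hα (by omega) (by omega)
    (c := c) hc hc0
  have hmin' := fun y hy hy0 => le_hammingNorm_of_mem_dual_codeC (k := k) hα (by omega) (by omega)
    (y := y) hy hy0
  have hcompl : ∀ S, S ∈ zeroSumSets (point q α) (q - 1 - k) ↔
      Sᶜ ∈ zeroSumSets (point q α) k := by
    intro S
    constructor
    · intro hS
      have := compl_mem_zeroSumSets hsum hS
      rwa [Nat.sub_sub_self (by omega)] at this
    · intro hS
      have := compl_mem_zeroSumSets hsum hS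
      rwa [compl_compl] at this
  have hC := suppMultiset_eq (C := codeC q k α) (w := q - 1 - k) (by omega) hmin
    (B := zeroSumSets (point q α) (q - 1 - k))
    (fun c hc hcw => (hcompl _).2 (compl_supp_mem_zeroSumSets hα (by omega) (by omega) hc hcw))
    (fun S hS => ⟨(mem_zeroSumSets.1 hS).1, by
      have := exists_mem_codeC_supp hα (by omega) (by omega) ((hcompl S).1 hS)
      rwa [compl_compl] at this⟩)
  have hD := suppMultiset_eq (C := dual (codeC q k α)) (w := k) (by omega) hmin'
    (B := zeroSumSets (point q α) k)
    (fun c hc hcw => supp_mem_zeroSumSets hα (by omega) (by omega) hc hcw)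
    (fun S hS => ⟨(mem_zeroSumSets.1 hS).1,
      exists_mem_dual_codeC_supp hα (by omega) (by omega) hS⟩)
  obtain ⟨S, hS⟩ := zeroSumSets_nonempty hP himg hk3 (by omega)
  have hScard := (mem_zeroSumSets.1 hS).1
  have hdC : minDist (codeC q k α) = q - 1 - k := by
    obtain ⟨c, hc, hcS⟩ := exists_mem_codeC_supp hα (by omega) (by omega) hS
    have hw : hammingNorm c = q - 1 - k := by
      rw [← card_supp, hcS, Finset.card_compl, Fintype.card_fin, hScard]
    refine minDist_eq hmin hc ?_ hw
    rintro rfl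
    rw [hammingNorm_zero] at hw
    omega
  have hdD : minDist (dual (codeC q k α)) = k := by
    obtain ⟨c, hc, hcS⟩ := exists_mem_dual_codeC_supp hα (by omega) (by omega) hS
    have hw : hammingNorm c = k := by rw [← card_supp, hcS, hScard]
    refine minDist_eq hmin' hc ?_ hw
    rintro rfl
    rw [hammingNorm_zero] at hw
    omega
  have hrC := finrank_codeC (k := k) hα (by omega)
  have hrD := finrank_dual_codeC (k := k) hα (by omega)
  obtain ⟨l₁, hl₁, hd₁⟩ := exists_isDesign_zeroSumSets hP himg (m := k) (by omega) (by omega)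
    (by omega)
  -- The value of `lambdaOne` at q - 1 - k is discarded; l₂ is computed from l₁ by comparing block
  -- counts.
  obtain ⟨l₂, -, hd₂⟩ := exists_isDesign_zeroSumSets hP himg (m := q - 1 - k) (by omega)
    (by omega) (by omega)
  rw [hF] at hl₁
  rw [show q - k - 1 = q - 1 - k by omega]
  refine ⟨⟨?_, ?_⟩, ⟨hrC, hdC⟩, l₁, l₂, hl₁, ?_, ⟨_, by rw [hdD]; exact hD, hd₁⟩,
    ⟨_, by rw [hdC]; exact hC, hd₂⟩⟩
  · rw [singletonDefect, hrC, hdC]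
    omega
  · rw [singletonDefect, hrD, hdD]
    omega
  · have e₁ := hd₁.card_mul_eq
    have e₂ := hd₂.card_mul_eq
    -- Complementation makes the block counts equal, so e₁ and e₂ determine the ratio l₂ : l₁.
    rw [card_zeroSumSets_sub hsum (by omega)] at e₂
    obtain ⟨r, rfl⟩ : ∃ r, k = r + 2 := ⟨k - 2, by omega⟩
    have e₃ := choose_mul_eq_choose_mul (q - 3) r
    rw [show q - 3 - r = q - 1 - (r + 2) by omega] at e₃
    have hpos : 0 < (q - 3).choose r := Nat.choose_pos (by omega)
    rw [lambdaTwo, ← hl₁, Nat.add_sub_cancel, eq_div_iff (by exact_mod_cast hpos.ne')]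
    rw [show r + 2 - 1 = r + 1 by omega] at e₁
    have hv : 0 < (q - 1) * (q - 1 - 1) := Nat.mul_pos (by omega) (by omega)
    have hr : 0 < (r + 2) * (r + 1) := by positivity
    have key : l₂ * (q - 3).choose r = l₁ * (q - 3).choose (r + 2) := by
      refine Nat.eq_of_mul_eq_mul_right (Nat.mul_pos hv hr) ?_
      calc l₂ * (q - 3).choose r * ((q - 1) * (q - 1 - 1) * ((r + 2) * (r + 1)))
          = l₂ * ((q - 1) * (q - 1 - 1)) * ((q - 3).choose r * ((r + 2) * (r + 1))) := by ring
        _ = (zeroSumSets (point q α) (r + 2)).card * ((r + 2) * (r + 1)) *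
            ((q - 3).choose r * ((q - 1 - (r + 2)) * (q - 1 - (r + 2) - 1))) := by
          rw [← e₂]; ring
        _ = l₁ * (q - 3).choose (r + 2) * ((q - 1) * (q - 1 - 1) * ((r + 2) * (r + 1))) := by
          rw [e₁, ← e₃]; ring
    exact_mod_cast key
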